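/- For $\varepsilon>0$ and an irrational $\alpha\in(0,1)$ (a representative of a class in $\mathbb R/\mathbb Z$), let the boundary function $\mathscr B_\alpha=\mathscr B_{\alpha,\varepsilon}:[0,\infty)\to\mathbb R$ be $$\mathscr B_\alpha(r)=\inf_{j\ge 1}u_{\alpha,j}(r),\qquad u_{\alpha,j}(r)=c(\varepsilon)\sqrt{4\sin^2(\pi j\alpha)\,r^2+j^2},\qquad c(\varepsilon)=\frac1{\sqrt{2\cosh\varepsilon-2}} .$$ (For $\varepsilon$ at most the Margulis constant of $\mathbb H^4$, $\{t>\mathscr B_\alpha(r)\}$ is the Margulis region of the screw translation $(r,\theta,z,t)\mapsto(r,\theta+\alpha,z+1,t)$ of $\mathbb H^4$, where $(r,\theta,z)$ are cylindrical coordinates on $\mathbb R^3$ with $\theta\in\mathbb R/\mathbb Z$, and $t>0$.) Let $q_n$ be the denominators of the continued fraction convergents of $\alpha$, with $q_0=1$. **Theorem.** There exists an irrational number $\alpha\in(0,1)$ which is a Liouville number and has $q_{n+1}$ of order $\exp(q_n)$ (that is, $C^{-1}e^{q_n}\le q_{n+1}\le C e^{q_n}$ for some constant $C\ge1$ and all large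 $n$), such that for every $\varepsilon>0$ $$\liminf_{r\to\infty}\frac{\log\mathscr B_\alpha(r)}{\log r}=0<\frac12=\limsup_{r\to\infty}\frac{\log\mathscr B_\alpha(r)}{\log r}.$$ -/

import Mathlib

open Filter Asymptotics

namespace Margulis

/-- The constant `c(ε) = 1 / √(2 cosh ε - 2)`. -/
noncomputable def c (ε : ℝ) : ℝ := 1 / √(2 * Real.cosh ε - 2)

/-- `u_{α,j}(r) = c(ε) √(4 sin²(π j α) r² + j²)`: the point `(r, θ, z, t)` of the upper half-space
is moved a hyperbolic distance less than `ε` by the `j`-th iterate of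
`(r, θ, z, t) ↦ (r, θ + α, z + 1, t)` exactly when `t > u_{α,j}(r)`. -/
noncomputable def u (ε α : ℝ) (j : ℕ) (r : ℝ) : ℝ :=
  c ε * √(4 * Real.sin (Real.pi * j * α) ^ 2 * r ^ 2 + (j : ℝ) ^ 2)

/-- The boundary function `𝓑_α(r) = inf_{j ≥ 1} u_{α,j}(r)` of the Margulis region. -/
noncomputable def boundary (ε α : ℝ) (r : ℝ) : ℝ := ⨅ j : ℕ+, u ε α j r

/-- The denominator `q_n` of the `n`-th convergent `[a₁, …, a_n]` of the continued fraction
of `α ∈ (0, 1)`, so that `q_0 = 1` and `q_1 = a₁`. -/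
noncomputable def q (α : ℝ) (n : ℕ) : ℝ := (GenContFract.of α).dens n

end Margulis

namespace Margulis

/-! Write ‖x‖ for the distance to the nearest integer; up to constants, u_j(r) is max(‖jα‖ r, j).
Dirichlet's theorem gives a j with both terms at most √r, so 𝓑 = O(√r) for every α
(`boundary_le_sqrt`). At r = q_n² this is sharp: no j < q_n has ‖jα‖ < 1/(2 q_n), so 𝓑 ≥ c q_n
(`le_boundary_sq`, `le_abs_mul_sub`). At r = q_{n+1}, j = q_n has ‖jα‖ r ≤ 1, so 𝓑 = O(q_n), which
is O(log r) once q_{n+1} ≥ exp(q_n). Such an α comes from the partial quotients ⌊exp(q_n)/q_n⌋ + 1.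
It is obtained as a limit of convergents (`exists_value`), and the errors |q_n α - p_n| identify its
continued fraction (`s_get?_of_backward_recurrence`). -/

/-- The solutions of the recurrence satisfied by the numerators and by the denominators of the
convergents of the continued fraction `[0; a 0, a 1, …]`. -/
def IsContinuant (a : ℕ → ℕ) (x : ℕ → ℝ) : Prop := ∀ n, x (n + 2) = a n * x (n + 1) + x n

/-! ### Continuants and the value of a continued fraction. -/

namespace IsContinuant

variable {a : ℕ → ℕ} {P Q : ℕ → ℝ}

theorem det (hP : IsContinuant a P) (hQ : IsContinuant a Q) (n : ℕ) :
    P (n + 1) * Q n - P n * Q (n + 1) = (-1) ^ n * (P 1 * Q 0 - P 0 * Q 1) := by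
  induction n with
  | zero => simp
  | succ n ih =>
    rw [hP n, hQ n, pow_succ]
    linear_combination -ih

theorem sub_mul (hP : IsContinuant a P) (hQ : IsContinuant a Q) (α : ℝ) :
    IsContinuant a (fun n => Q n * α - P n) := by
  intro n
  simp only [hP n, hQ n]
  ring

theorem pos (hQ : IsContinuant a Q) (ha : ∀ n, 1 ≤ a n) (h0 : Q 0 = 0) (h1 : Q 1 = 1) (n : ℕ) :
    0 < Q (n + 1) := by
  have key : 0 ≤ Q n ∧ 0 < Q (n + 1) := by
    induction n with
    | zero => simp [h0, h1]
    | succ n ih =>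
      have : (1 : ℝ) ≤ a n := mod_cast ha n
      exact ⟨ih.2.le, by rw [hQ n]; nlinarith⟩
  exact key.2

/-- The value `α` of the continued fraction `[0; a 0, a 1, …]` lies strictly between any two
consecutive convergents. -/
theorem exists_value (hP : IsContinuant a P) (hQ : IsContinuant a Q) (ha : ∀ n, 1 ≤ a n)
    (hP0 : P 0 = 1) (hP1 : P 1 = 0) (hQ0 : Q 0 = 0) (hQ1 : Q 1 = 1) :
    ∃ α : ℝ, ∀ n, 0 < (-1) ^ (n + 1) * (Q n * α - P n) := by
  have hpos := hQ.pos ha hQ0 hQ1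
  have hdet : ∀ n, P (n + 1) * Q n - P n * Q (n + 1) = -(-1) ^ n := fun n => by
    rw [det hP hQ, hP0, hP1, hQ0, hQ1]; ring
  have hev : ∀ k, ((-1 : ℝ)) ^ (2 * k) = 1 := fun k => by simp [pow_mul]
  have hL : StrictMono (fun k => P (2 * k + 1) / Q (2 * k + 1)) := by
    refine strictMono_nat_of_lt_succ fun k => ?_
    rw [div_lt_div_iff₀ (hpos _) (hpos _)]
    have h1 := hdet (2 * k + 1)
    have h3 := hP (2 * k + 1)
    have h4 := hQ (2 * k + 1)
    rw [pow_succ, hev] at h1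
    simp only [Nat.mul_add, mul_one, Nat.add_right_comm _ 2 1] at *
    norm_num [add_assoc] at *
    rw [h3, h4]
    have : (1 : ℝ) ≤ a (2 * k + 1) := Nat.one_le_cast.2 (ha _)
    nlinarith
  have hU : StrictAnti (fun k => P (2 * k + 2) / Q (2 * k + 2)) := by
    refine strictAnti_nat_of_succ_lt fun k => ?_
    rw [div_lt_div_iff₀ (hpos _) (hpos _)]
    have h1 := hdet (2 * k + 2)
    have h3 := hP (2 * k + 2)
    have h4 := hQ (2 * k + 2)
    rw [pow_add, hev] at h1
    norm_num [Nat.mul_add, add_assoc] at *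
    rw [h3, h4]
    have : (1 : ℝ) ≤ a (2 * k + 2) := Nat.one_le_cast.2 (ha _)
    nlinarith
  have hLU : ∀ k, P (2 * k + 1) / Q (2 * k + 1) ≤ P (2 * k + 2) / Q (2 * k + 2) := by
    intro k
    rw [div_le_div_iff₀ (hpos _) (hpos _)]
    have h1 := hdet (2 * k + 1)
    rw [pow_succ, hev] at h1
    norm_num [add_assoc] at *
    linarith
  have hmem := hL.monotone.ciSup_mem_iInter_Icc_of_antitone hU.antitone hLU
  rw [Set.mem_iInter] at hmem
  generalize (⨆ n, P (2 * n + 1) / Q (2 * n + 1)) = α at hmem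
  refine ⟨α, fun n => ?_⟩
  obtain ⟨k, rfl | rfl⟩ := n.even_or_odd'
  · rw [pow_succ, hev]
    rcases k with _ | k
    -- Index 0 is the formal convergent 1/0, outside both monotone sequences.
    · simp [hP0, hQ0]
    · have h := (hmem (k + 1)).2.trans_lt (hU k.lt_succ_self)
      rw [lt_div_iff₀ (hpos _)] at h
      norm_num [Nat.mul_add] at *
      linarith
  · have h := (hL k.lt_succ_self).trans_le (hmem (k + 1)).1
    rw [div_lt_iff₀ (hpos _)] at h
    rw [show 2 * k + 1 + 1 = 2 * (k + 1) by ring, hev]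
    norm_num at *
    linarith

/-- The error terms `|Q n * α - P n|` satisfy the backward recurrence. -/
theorem alternating_eq (hQ : IsContinuant a Q) (n : ℕ) :
    (-1) ^ (n + 1) * Q n =
      a n * ((-1) ^ (n + 1 + 1) * Q (n + 1)) + (-1) ^ (n + 2 + 1) * Q (n + 2) := by
  rw [hQ n]
  ring

end IsContinuant

/-! ### Recovering the partial quotients from the error terms. -/

section Stream

open GenContFract

variable {a : ℕ → ℕ} {E : ℕ → ℝ}

theorem div_mem_Ioo_of_backward_recurrence (ha : ∀ n, 1 ≤ a n)
    (hE : ∀ n, E n = a n * E (n + 1) + E (n + 2)) (hpos : ∀ n, 0 < E n) (n : ℕ) :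
    E (n + 1) / E n ∈ Set.Ioo (0 : ℝ) 1 := by
  refine ⟨div_pos (hpos _) (hpos _), (div_lt_one (hpos _)).2 ?_⟩
  have h1 : (1 : ℝ) ≤ a n := mod_cast ha n
  nlinarith [hE n, hpos (n + 1), hpos (n + 2)]

/-- One step of the Gauss map: dividing the recurrence by `E (n + 1)` displays the integer and
fractional parts. -/
theorem of_inv_div_of_backward_recurrence (ha : ∀ n, 1 ≤ a n)
    (hE : ∀ n, E n = a n * E (n + 1) + E (n + 2)) (hpos : ∀ n, 0 < E n) (n : ℕ) :
    IntFractPair.of (E (n + 1) / E n)⁻¹ = ⟨a n, E (n + 2) / E (n + 1)⟩ := by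
  have h : (E (n + 1) / E n)⁻¹ = (a n : ℤ) + E (n + 2) / E (n + 1) := by
    have := (hpos (n + 1)).ne'
    rw [inv_div, hE n]
    rw [Int.cast_natCast, add_div, mul_div_cancel_right₀ _ this]
  obtain ⟨h0, h1⟩ := div_mem_Ioo_of_backward_recurrence ha hE hpos (n + 1)
  rw [h, IntFractPair.of, Int.floor_intCast_add, Int.fract_intCast_add,
    Int.floor_eq_zero_iff.2 ⟨h0.le, h1⟩, Int.fract_eq_self.2 ⟨h0.le, h1⟩, add_zero]

theorem exists_stream_eq_of_backward_recurrence (ha : ∀ n, 1 ≤ a n)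
    (hE : ∀ n, E n = a n * E (n + 1) + E (n + 2)) (hpos : ∀ n, 0 < E n) (h0 : E 0 = 1) (n : ℕ) :
    ∃ b, IntFractPair.stream (E 1) n = some ⟨b, E (n + 1) / E n⟩ := by
  induction n with
  | zero =>
    have h := div_mem_Ioo_of_backward_recurrence ha hE hpos 0
    rw [zero_add, h0, div_one] at *
    exact ⟨⌊E 1⌋, by
      rw [IntFractPair.stream_zero, IntFractPair.of, Int.fract_eq_self.2 ⟨h.1.le, h.2⟩]⟩
  | succ n ih =>
    obtain ⟨b, hb⟩ := ih
    exact ⟨a n, by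
      rw [IntFractPair.stream_succ_of_some hb
        (div_mem_Ioo_of_backward_recurrence ha hE hpos n).1.ne',
        of_inv_div_of_backward_recurrence ha hE hpos]⟩

theorem s_get?_of_backward_recurrence (ha : ∀ n, 1 ≤ a n)
    (hE : ∀ n, E n = a n * E (n + 1) + E (n + 2)) (hpos : ∀ n, 0 < E n) (h0 : E 0 = 1) (n : ℕ) :
    (GenContFract.of (E 1)).s.get? n = some ⟨1, a n⟩ := by
  obtain ⟨b, hb⟩ := exists_stream_eq_of_backward_recurrence ha hE hpos h0 n
  rw [get?_of_eq_some_of_get?_intFractPair_stream_fr_ne_zero hb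
    (div_mem_Ioo_of_backward_recurrence ha hE hpos n).1.ne',
    of_inv_div_of_backward_recurrence ha hE hpos, Int.cast_natCast]

theorem q_eq_of_s_get? {Q : ℕ → ℝ} {α : ℝ} (hQ : IsContinuant a Q) (hQ0 : Q 0 = 0) (hQ1 : Q 1 = 1)
    (hs : ∀ n, (GenContFract.of α).s.get? n = some ⟨1, a n⟩) (n : ℕ) : q α n = Q (n + 1) := by
  have key : q α n = Q (n + 1) ∧ q α (n + 1) = Q (n + 2) := by
    induction n with
    | zero => exact ⟨hQ1.symm, by rw [hQ 0, hQ0, hQ1]; simpa [q] using first_den_eq (hs 0)⟩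
    | succ n ih =>
      refine ⟨ih.2, ?_⟩
      have := dens_recurrence (hs (n + 1)) ih.1 ih.2
      rw [one_mul] at this
      rw [hQ (n + 1), ← this]; rfl
  exact key.1

end Stream

/-! ### Comparing |sin πx| with the distance from x to the integers. -/

theorem c_pos {ε : ℝ} (hε : 0 < ε) : 0 < c ε := by
  have : 1 < Real.cosh ε := Real.one_lt_cosh.2 hε.ne'
  exact one_div_pos.2 (Real.sqrt_pos.2 (by linarith))

theorem sin_pi_mul_sq_eq (x : ℝ) (m : ℤ) :
    Real.sin (Real.pi * x) ^ 2 = Real.sin (Real.pi * (x - m)) ^ 2 := by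
  rw [mul_sub, mul_comm Real.pi (m : ℝ), Real.sin_sub_int_mul_pi, mul_pow]
  rcases m.even_or_odd with h | h <;> simp [h.neg_one_zpow]

theorem sin_pi_mul_sq_le (x : ℝ) (m : ℤ) :
    Real.sin (Real.pi * x) ^ 2 ≤ (Real.pi * |x - m|) ^ 2 := by
  rw [sin_pi_mul_sq_eq x m, mul_pow, sq_abs, ← mul_pow]
  exact sq_le_sq.2 Real.abs_sin_le_abs

theorem le_sin_pi_mul_sq (x : ℝ) :
    (2 * |x - round x|) ^ 2 ≤ Real.sin (Real.pi * x) ^ 2 := by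
  rw [sin_pi_mul_sq_eq x (round x)]
  have h := abs_sub_round x
  have hpi := Real.pi_pos
  have h2 := Real.mul_abs_le_abs_sin (x := Real.pi * (x - round x)) (by
    rw [abs_mul, abs_of_pos hpi]; nlinarith)
  rw [abs_mul, abs_of_pos hpi] at h2
  refine sq_le_sq.2 (le_trans (le_of_eq ?_) h2)
  rw [abs_mul, abs_abs]
  rw [abs_two]
  field_simp

/-! ### Bounds for the boundary function. -/

section Boundary

variable {ε : ℝ} (α r : ℝ)

theorem c_mul_le_u (hε : 0 < ε) (j : ℕ) : c ε * j ≤ u ε α j r :=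
  mul_le_mul_of_nonneg_left (Real.le_sqrt_of_sq_le
    (by nlinarith [sq_nonneg (Real.sin (Real.pi * j * α) * r)])) (c_pos hε).le

theorem boundary_le_u (hε : 0 < ε) {j : ℕ} (hj : 0 < j) : boundary ε α r ≤ u ε α j r := by
  refine ciInf_le (f := fun j : ℕ+ => u ε α j r) ⟨0, ?_⟩ ⟨j, hj⟩
  rintro _ ⟨i, rfl⟩
  exact (mul_nonneg (c_pos hε).le i.1.cast_nonneg).trans (c_mul_le_u α r hε i)

theorem c_le_boundary (hε : 0 < ε) : c ε ≤ boundary ε α r := by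
  refine le_ciInf fun j => le_trans ?_ (c_mul_le_u α r hε j)
  have : (1 : ℝ) ≤ j := mod_cast j.2
  nlinarith [c_pos hε]

/-- If `j ≤ s` and `‖j α‖ |r| ≤ s`, then `𝓑_α(r)` is at most a constant times `s`. -/
theorem boundary_le_of_abs_le (hε : 0 < ε) {j : ℕ} (hj : 0 < j) {m : ℤ} {s : ℝ}
    (hjs : j ≤ s) (hm : |j * α - m| * |r| ≤ s) :
    boundary ε α r ≤ c ε * √(4 * Real.pi ^ 2 + 1) * s := by
  refine (boundary_le_u α r hε hj).trans ?_
  have hs : 0 ≤ s := j.cast_nonneg.trans hjs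
  rw [u, mul_assoc (c ε)]
  refine mul_le_mul_of_nonneg_left ?_ (c_pos hε).le
  rw [← Real.sqrt_sq hs, ← Real.sqrt_mul (by positivity)]
  refine Real.sqrt_le_sqrt ?_
  have h1 := sin_pi_mul_sq_le (j * α) m
  rw [← mul_assoc] at h1
  have h2 : (|j * α - m| * |r|) ^ 2 ≤ s ^ 2 := pow_le_pow_left₀ (by positivity) hm 2
  have h3 : (j : ℝ) ^ 2 ≤ s ^ 2 := pow_le_pow_left₀ (by positivity) hjs 2
  have h4 := mul_le_mul_of_nonneg_right h1 (sq_nonneg r)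
  have h5 := mul_le_mul_of_nonneg_left h2 (sq_nonneg Real.pi)
  rw [mul_pow _ |r|, sq_abs r] at h5
  nlinarith

theorem boundary_le_sqrt (hε : 0 < ε) {r : ℝ} (hr : 1 ≤ r) :
    boundary ε α r ≤ c ε * √(4 * Real.pi ^ 2 + 1) * √r := by
  have hs : 1 ≤ √r := Real.one_le_sqrt.2 hr
  -- Dirichlet's theorem with denominators up to ⌊√r⌋.
  obtain ⟨k, hk0, hkn, hk⟩ := Real.exists_nat_abs_mul_sub_round_le α (Nat.floor_pos.2 hs)
  refine boundary_le_of_abs_le α r hε hk0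
    ((Nat.cast_le.2 hkn).trans (Nat.floor_le (by positivity))) (m := round (k * α)) ?_
  rw [abs_of_nonneg (a := r) (by linarith)]
  have h1 := (Nat.lt_floor_add_one (√r)).le
  have h2 := hk.trans (one_div_le_one_div_of_le (by linarith) h1)
  calc _ ≤ 1 / √r * r := mul_le_mul_of_nonneg_right h2 (by linarith)
    _ = √r := by rw [one_div, inv_mul_eq_div, Real.div_sqrt]

/-- If `‖j α‖ ≥ 1 / (2 s)` for all `j < s`, then `𝓑_α(s²) ≥ c(ε) s`. -/
theorem le_boundary_sq (hε : 0 < ε) {s : ℝ} (hs : 0 < s)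
    (h : ∀ j : ℕ, 0 < j → (j : ℝ) < s → ∀ m : ℤ, 1 / (2 * s) ≤ |j * α - m|) :
    c ε * s ≤ boundary ε α (s ^ 2) := by
  refine le_ciInf fun j => ?_
  -- For large j the term j² suffices; for small j the sine term does.
  rcases le_or_gt s j with hj | hj
  · exact (mul_le_mul_of_nonneg_left hj (c_pos hε).le).trans (c_mul_le_u α _ hε j)
  · refine mul_le_mul_of_nonneg_left (Real.le_sqrt_of_sq_le ?_) (c_pos hε).le
    have h1 := le_sin_pi_mul_sq (j * α)
    have h2 : 1 / s ≤ 2 * |j * α - round (j * α)| := by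
      have := h j j.2 hj (round (j * α))
      rw [one_div, mul_inv] at this
      rw [one_div]; linarith
    have h3 := (pow_le_pow_left₀ (by positivity) h2 2).trans h1
    rw [← mul_assoc] at h3
    have h4 := mul_le_mul_of_nonneg_right h3 (sq_nonneg (s ^ 2))
    have h5 : (1 / s) ^ 2 * (s ^ 2) ^ 2 = s ^ 2 := by field_simp
    rw [h5] at h4
    nlinarith [sq_nonneg (j : ℝ)]

end Boundary

/-! ### Lower and upper growth exponents. -/

section Limits

/-- A bound valid for all large arguments gives one inequality, a sequence of good arguments the
other. -/
theorem liminf_coe_eq {f g : ℝ → ℝ} {r h : ℕ → ℝ} {l : ℝ} (hg : Tendsto g atTop (nhds l))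
    (hgf : g ≤ᶠ[atTop] f) (hr : Tendsto r atTop atTop) (hh : Tendsto h atTop (nhds l))
    (hfh : f ∘ r ≤ᶠ[atTop] h) : liminf (fun x => (f x : EReal)) atTop = (l : EReal) := by
  have hg' := (continuous_coe_real_ereal.tendsto l).comp hg
  have hh' := (continuous_coe_real_ereal.tendsto l).comp hh
  refine le_antisymm ?_ ?_
  · refine (liminf_le_liminf_of_le (g := map r atTop) hr).trans ?_
    rw [← hh'.liminf_eq]
    exact liminf_le_liminf (u := fun n => (f (r n) : EReal))
      (hfh.mono fun n hn => EReal.coe_le_coe_iff.2 hn)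
  · rw [← hg'.liminf_eq]
    exact liminf_le_liminf (hgf.mono fun n hn => EReal.coe_le_coe_iff.2 hn)

theorem limsup_coe_eq {f g : ℝ → ℝ} {r h : ℕ → ℝ} {l : ℝ} (hg : Tendsto g atTop (nhds l))
    (hgf : f ≤ᶠ[atTop] g) (hr : Tendsto r atTop atTop) (hh : Tendsto h atTop (nhds l))
    (hfh : h ≤ᶠ[atTop] f ∘ r) : limsup (fun x => (f x : EReal)) atTop = (l : EReal) := by
  have hg' := (continuous_coe_real_ereal.tendsto l).comp hg
  have hh' := (continuous_coe_real_ereal.tendsto l).comp hh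
  refine le_antisymm ?_ ?_
  · rw [← hg'.limsup_eq]
    exact limsup_le_limsup (hgf.mono fun n hn => EReal.coe_le_coe_iff.2 hn)
  · refine le_trans ?_ (limsup_le_limsup_of_le (f := map r atTop) hr)
    rw [← hh'.limsup_eq]
    exact limsup_le_limsup (v := fun n => (f (r n) : EReal))
      (hfh.mono fun n hn => EReal.coe_le_coe_iff.2 hn)

theorem tendsto_log_mul_sqrt_div_log {C : ℝ} (hC : 0 < C) :
    Tendsto (fun r => Real.log (C * √r) / Real.log r) atTop (nhds (1 / 2)) := by
  have h : Tendsto (fun r => Real.log C / Real.log r + 1 / 2) atTop (nhds (0 + 1 / 2)) :=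
    (tendsto_const_nhds.div_atTop Real.tendsto_log_atTop).add_const _
  rw [zero_add] at h
  refine h.congr' ?_
  filter_upwards [eventually_gt_atTop 1] with r hr
  have := (Real.log_pos hr).ne'
  rw [Real.log_mul hC.ne' (by positivity), Real.log_sqrt (by linarith)]
  field_simp

theorem limsup_log_boundary {ε α : ℝ} (hε : 0 < ε) {s : ℕ → ℝ} (hs : Tendsto s atTop atTop)
    (h : ∀ᶠ n in atTop, ∀ j : ℕ, 0 < j → (j : ℝ) < s n → ∀ m : ℤ, 1 / (2 * s n) ≤ |j * α - m|) :
    limsup (fun r : ℝ => ((Real.log (boundary ε α r) / Real.log r : ℝ) : EReal)) atTop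
      = ((1 / 2 : ℝ) : EReal) := by
  have hc := c_pos hε
  have hr : Tendsto (fun n => s n ^ 2) atTop atTop := (tendsto_pow_atTop two_ne_zero).comp hs
  refine limsup_coe_eq (tendsto_log_mul_sqrt_div_log (C := c ε * √(4 * Real.pi ^ 2 + 1))
    (by positivity)) ?_ hr ((tendsto_log_mul_sqrt_div_log hc).comp hr) ?_
  · filter_upwards [eventually_ge_atTop 1] with r hr
    have := hc.trans_le (c_le_boundary α r hε)
    exact div_le_div_of_nonneg_right (Real.log_le_log this (boundary_le_sqrt α hε hr))
      (Real.log_nonneg hr)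
  · filter_upwards [h, hs.eventually_ge_atTop 1] with n hn h1
    have h0 : 0 < s n := by linarith
    refine div_le_div_of_nonneg_right ?_ (Real.log_nonneg (one_le_pow₀ h1))
    rw [Real.sqrt_sq h0.le]
    exact Real.log_le_log (by positivity) (le_boundary_sq α hε h0 hn)

theorem liminf_log_boundary {ε α : ℝ} (hε : 0 < ε) {s : ℕ → ℕ} {r : ℕ → ℝ}
    (hs : Tendsto s atTop atTop) (hr : ∀ n, Real.exp (s n) ≤ r n) (h : ∀ n, ∃ m : ℤ, |s n * α - m| ≤ 1 / r n) :
    liminf (fun r : ℝ => ((Real.log (boundary ε α r) / Real.log r : ℝ) : EReal)) atTop = 0 := by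
  have hc := c_pos hε
  have hs' : Tendsto (fun n => (s n : ℝ)) atTop atTop := tendsto_natCast_atTop_atTop.comp hs
  set C := c ε * √(4 * Real.pi ^ 2 + 1) with hC
  have hCpos : 0 < C := by positivity
  refine liminf_coe_eq (g := fun r => Real.log (c ε) / Real.log r)
    (h := fun n => |Real.log C| / s n + Real.log (s n) / s n)
    (tendsto_const_nhds.div_atTop Real.tendsto_log_atTop) ?_
    (tendsto_atTop_mono hr (Real.tendsto_exp_atTop.comp hs')) ?_ ?_
  · filter_upwards [eventually_ge_atTop 1] with r hr
    exact div_le_div_of_nonneg_right (Real.log_le_log hc (c_le_boundary α r hε))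
      (Real.log_nonneg hr)
  · have := (tendsto_const_nhds (x := |Real.log C|)).div_atTop hs'
    simpa using this.add (Real.isLittleO_log_id_atTop.tendsto_div_nhds_zero.comp hs')
  · filter_upwards [hs.eventually_ge_atTop 1] with n hn
    have hn' : (1 : ℝ) ≤ s n := mod_cast hn
    have hrpos : 0 < r n := (Real.exp_pos _).trans_le (hr n)
    obtain ⟨m, hm⟩ := h n
    have h1 : boundary ε α (r n) ≤ C * s n := by
      refine boundary_le_of_abs_le α _ hε hn le_rfl (m := m) ?_
      rw [abs_of_pos hrpos]
      rw [le_div_iff₀ hrpos] at hm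
      exact hm.trans hn'
    have h2 := Real.log_le_log (hc.trans_le (c_le_boundary α (r n) hε)) h1
    rw [Real.log_mul hCpos.ne' (by positivity)] at h2
    have h3 : (s n : ℝ) ≤ Real.log (r n) := (Real.le_log_iff_exp_le hrpos).2 (hr n)
    have h4 := Real.log_nonneg hn'
    rw [← add_div]
    refine (div_le_div_of_nonneg_right (h2.trans (add_le_add_left (le_abs_self _) _))
      (by linarith)).trans ?_
    exact div_le_div_of_nonneg_left (by positivity) (by linarith) h3

end Limits

/-! ### Quality of approximation by convergents. -/

section Approximation

variable {a P Q : ℕ → ℕ} {α : ℝ}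

/-- With E n = |Q n α - P n|, the determinant identity reads Q (n+1) E n + Q n E (n+1) = 1. -/
theorem abs_mul_sub_le (hP : IsContinuant a (fun n => P n)) (hQ : IsContinuant a (fun n => Q n))
    (hP0 : P 0 = 1) (hP1 : P 1 = 0) (hQ0 : Q 0 = 0) (hQ1 : Q 1 = 1)
    (hα : ∀ n, 0 < (-1) ^ (n + 1) * (Q n * α - P n)) {n : ℕ} (hn : 0 < Q (n + 1)) :
    |Q n * α - P n| ≤ 1 / Q (n + 1) := by
  have h := hP.det hQ n
  simp only [hP0, hP1, hQ0, hQ1] at h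
  have h1 : |Q n * α - P n| = (-1) ^ (n + 1) * (Q n * α - P n) := by
    rw [← abs_of_pos (hα n), abs_mul, abs_pow]
    simp
  have h2 := mul_nonneg (Q n).cast_nonneg (hα (n + 1)).le
  have h3 : ((-1 : ℝ)) ^ n * (-1) ^ n = 1 := by rw [← mul_pow]; simp
  rw [le_div_iff₀ (by exact_mod_cast hn), h1]
  simp only [pow_succ] at h2 ⊢
  push_cast at h
  linear_combination h2 - (-1) ^ n * h + h3

/-- The integer j P n - m Q n is nonzero, and replacing P n by Q n α changes it by at most j / Q
(n+1) ≤ 1/2. -/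
theorem le_abs_mul_sub (hP : IsContinuant a (fun n => P n)) (hQ : IsContinuant a (fun n => Q n))
    (hP0 : P 0 = 1) (hP1 : P 1 = 0) (hQ0 : Q 0 = 0) (hQ1 : Q 1 = 1)
    (hα : ∀ n, 0 < (-1) ^ (n + 1) * (Q n * α - P n)) {n : ℕ} (hn : 0 < Q n)
    (hgrow : 2 * Q n ≤ Q (n + 1)) {j : ℕ} (hj0 : 0 < j) (hj : (j : ℝ) < Q n) (m : ℤ) :
    1 / (2 * (Q n : ℝ)) ≤ |j * α - m| := by
  have hn' : (0 : ℝ) < Q n := mod_cast hn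
  have hg : (2 : ℝ) * Q n ≤ Q (n + 1) := mod_cast hgrow
  have hne : (j * P n - m * Q n : ℤ) ≠ 0 := by
    intro h0
    have h0' : (j * P n - m * Q n : ℝ) = 0 := mod_cast h0
    have h := hP.det hQ n
    simp only [hP0, hP1, hQ0, hQ1] at h
    -- By the unit determinant, Q n would divide j, contradicting 0 < j < Q n.
    have h1 : (Q n : ℝ) * ((j * P (n + 1) - m * Q (n + 1) : ℤ) : ℝ) = (-1) ^ (n + 1) * j := by
      push_cast at h ⊢
      linear_combination (j : ℝ) * h + Q (n + 1) * h0'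
    have h2 := congrArg abs h1
    rw [abs_mul, abs_mul, abs_pow, abs_neg, abs_one, one_pow, one_mul, Nat.abs_cast,
      Nat.abs_cast] at h2
    have hk : (j * P (n + 1) - m * Q (n + 1) : ℤ) ≠ 0 := by
      intro hk
      rw [hk, Int.cast_zero, abs_zero, mul_zero] at h2
      exact hj0.ne (mod_cast h2)
    have h3 : (1 : ℝ) ≤ |((j * P (n + 1) - m * Q (n + 1) : ℤ) : ℝ)| :=
      mod_cast Int.one_le_abs hk
    nlinarith
  have h1 : (1 : ℝ) ≤ |(j * P n - m * Q n : ℝ)| := mod_cast Int.one_le_abs hne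
  have h2 := abs_mul_sub_le hP hQ hP0 hP1 hQ0 hQ1 hα (n := n) (by omega)
  rw [le_div_iff₀ (by linarith)] at h2
  have h3 : (j : ℝ) * |Q n * α - P n| ≤ 1 / 2 := by nlinarith [abs_nonneg (Q n * α - P n : ℝ)]
  have h4 : (j * P n - m * Q n : ℝ) = Q n * (j * α - m) - j * (Q n * α - P n) := by ring
  have h5 := abs_sub (Q n * (j * α - m) : ℝ) (j * (Q n * α - P n))
  rw [← h4, abs_mul, abs_mul, Nat.abs_cast, Nat.abs_cast] at h5
  rw [div_le_iff₀ (by linarith)]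
  linarith

end Approximation

/-! ### Denominators of exponential growth. -/

/-- The partial quotient that follows a convergent with denominator `d`. -/
noncomputable def expQuot (d : ℕ) : ℕ := ⌊Real.exp d / d⌋₊ + 1

/-- The denominators of the convergents, with the conventional initial term `0`. -/
noncomputable def expDen : ℕ → ℕ
  | 0 => 0
  | 1 => 1
  | n + 2 => expQuot (expDen (n + 1)) * expDen (n + 1) + expDen n

/-- The numerators of the convergents, with the conventional initial term `1`. -/
noncomputable def expNum : ℕ → ℕ
  | 0 => 1
  | 1 => 0
  | n + 2 => expQuot (expDen (n + 1)) * expNum (n + 1) + expNum n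

theorem isContinuant_expDen :
    IsContinuant (fun n => expQuot (expDen (n + 1))) (fun n => expDen n) := fun n => by
  simp [expDen]

theorem isContinuant_expNum :
    IsContinuant (fun n => expQuot (expDen (n + 1))) (fun n => expNum n) := fun n => by
  simp [expNum]

theorem expDen_pos (n : ℕ) : 0 < expDen (n + 1) := by
  exact_mod_cast isContinuant_expDen.pos (fun _ => Nat.le_add_left _ _) (by simp [expDen])
    (by simp [expDen]) n

theorem expDen_le_succ (n : ℕ) : expDen n ≤ expDen (n + 1) := by
  rcases n with _ | n
  · simp [expDen]
  · rw [expDen, expQuot]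
    exact (Nat.le_mul_of_pos_left _ (Nat.succ_pos _)).trans (Nat.le_add_right _ _)

theorem exp_expDen_le (n : ℕ) : Real.exp (expDen (n + 1)) ≤ expDen (n + 2) := by
  have hpos : (0 : ℝ) < expDen (n + 1) := mod_cast expDen_pos n
  have h := Nat.lt_floor_add_one (Real.exp (expDen (n + 1)) / expDen (n + 1))
  rw [div_lt_iff₀ hpos] at h
  rw [expDen, expQuot]
  push_cast
  linarith [(expDen n).cast_nonneg (α := ℝ)]

theorem expDen_le_exp (n : ℕ) : (expDen (n + 2) : ℝ) ≤ 3 * Real.exp (expDen (n + 1)) := by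
  have hpos : (0 : ℝ) < expDen (n + 1) := mod_cast expDen_pos n
  have h := Nat.floor_le (a := Real.exp (expDen (n + 1)) / expDen (n + 1)) (by positivity)
  rw [le_div_iff₀ hpos] at h
  have h1 : (expDen n : ℝ) ≤ expDen (n + 1) := mod_cast expDen_le_succ n
  -- The rounding up and the term `expDen n` each cost at most `expDen (n + 1)`, hence the constant
  -- 3.
  have h2 := Real.add_one_le_exp (expDen (n + 1) : ℝ)
  rw [expDen, expQuot]
  push_cast
  linarith

theorem two_mul_expDen_le (n : ℕ) : 2 * expDen (n + 1) ≤ expDen (n + 2) := by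
  have h := exp_expDen_le n
  have h1 := Real.quadratic_le_exp_of_nonneg (expDen (n + 1)).cast_nonneg
  have : (2 * expDen (n + 1) : ℝ) ≤ expDen (n + 2) := by
    nlinarith [sq_nonneg ((expDen (n + 1) : ℝ) - 1)]
  exact_mod_cast this

theorem tendsto_expDen : Tendsto (fun n => expDen (n + 1)) atTop atTop :=
  StrictMono.tendsto_atTop <| strictMono_nat_of_lt_succ fun n => by
    have := two_mul_expDen_le n
    have := expDen_pos n
    change expDen (n + 1) < expDen (n + 2)
    omega

/-- exp(-s) is eventually smaller than every power s^(-k). -/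
theorem liouville_of_exp_growth {α : ℝ} {s p : ℕ → ℕ} (hs : Tendsto s atTop atTop)
    (hne : ∀ n, s n * α - p n ≠ 0) (h : ∀ n, |s n * α - p n| ≤ Real.exp (-s n)) :
    Liouville α := by
  intro k
  have h1 : Tendsto (fun n => (s n : ℝ) ^ k * Real.exp (-s n)) atTop (nhds 0) :=
    (Real.tendsto_pow_mul_exp_neg_atTop_nhds_zero k).comp
      (tendsto_natCast_atTop_atTop (R := ℝ).comp hs)
  obtain ⟨n, hn1, hn2⟩ := ((h1.eventually_lt_const one_pos).and (hs.eventually_ge_atTop 2)).exists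
  have hpos : (1 : ℝ) < s n := mod_cast hn2
  have hpos' : (0 : ℝ) < s n := by linarith
  have heq : α - p n / s n = (s n * α - p n) / s n := by field_simp
  refine ⟨p n, s n, mod_cast hn2, ?_, ?_⟩ <;> push_cast
  · rw [← sub_ne_zero, heq]
    exact div_ne_zero (hne n) hpos'.ne'
  · rw [heq, abs_div, Nat.abs_cast, div_lt_div_iff₀ hpos' (by positivity)]
    have := mul_le_mul_of_nonneg_right (h n) (pow_nonneg hpos'.le k)
    linarith

end Margulis

theorem mainTheorem10 :
    ∃ α : ℝ, α ∈ Set.Ioo (0 : ℝ) 1 ∧ Irrational α ∧ Liouville α ∧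
      (fun n : ℕ => Margulis.q α (n + 1)) =Θ[atTop] (fun n : ℕ => Real.exp (Margulis.q α n)) ∧
      ∀ ε : ℝ, 0 < ε →
        liminf (fun r : ℝ =>
          ((Real.log (Margulis.boundary ε α r) / Real.log r : ℝ) : EReal)) atTop = 0 ∧
        limsup (fun r : ℝ =>
          ((Real.log (Margulis.boundary ε α r) / Real.log r : ℝ) : EReal)) atTop
            = ((1 / 2 : ℝ) : EReal) := by
  open Margulis in
  have hP := isContinuant_expNum
  have hQ := isContinuant_expDen
  have hP0 : expNum 0 = 1 := by rw [expNum]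
  have hP1 : expNum 1 = 0 := by rw [expNum]
  have hQ0 : expDen 0 = 0 := by rw [expDen]
  have hQ1 : expDen 1 = 1 := by rw [expDen]
  have ha : ∀ n, 1 ≤ expQuot (expDen (n + 1)) := fun _ => Nat.le_add_left _ _
  obtain ⟨α, hα⟩ := IsContinuant.exists_value hP hQ ha (by simp [hP0]) (by simp [hP1])
    (by simp [hQ0]) (by simp [hQ1])
  -- The sign makes `E n` the absolute error; the initial values give `E 0 = 1` and `E 1 = α`, so
  -- the Gauss iteration starts at α.
  set E : ℕ → ℝ := fun n => (-1) ^ (n + 1) * (expDen n * α - expNum n) with hE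
  have hrec : ∀ n, E n = expQuot (expDen (n + 1)) * E (n + 1) + E (n + 2) :=
    (hP.sub_mul hQ α).alternating_eq
  have hE0 : E 0 = 1 := by simp [hE, hQ0, hP0]
  have hE1 : E 1 = α := by simp [hE, hQ1, hP1]
  have hs := s_get?_of_backward_recurrence ha hrec hα hE0
  have hmem := div_mem_Ioo_of_backward_recurrence ha hrec hα 0
  rw [zero_add, hE0, div_one, hE1] at hmem
  rw [hE1] at hs
  have hq : ∀ n, q α n = expDen (n + 1) :=
    q_eq_of_s_get? hQ (by simp [hQ0]) (by simp [hQ1]) hs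
  have happrox : ∀ n, |expDen (n + 1) * α - expNum (n + 1)| ≤ 1 / (expDen (n + 2) : ℝ) :=
    fun n => abs_mul_sub_le hP hQ hP0 hP1 hQ0 hQ1 hα (expDen_pos (n + 1))
  have hL : Liouville α := by
    refine liouville_of_exp_growth tendsto_expDen (p := fun n => expNum (n + 1))
      (fun n h0 => ?_) fun n => (happrox n).trans ?_
    · have := hα (n + 1)
      simp [h0] at this
    · rw [Real.exp_neg, ← one_div]
      exact one_div_le_one_div_of_le (Real.exp_pos _) (exp_expDen_le n)
  refine ⟨α, hmem, hL.irrational, hL, ?_, fun ε hε => ⟨?_, ?_⟩⟩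
  · simp only [hq]
    refine ⟨IsBigO.of_bound 3 (Eventually.of_forall fun n => ?_),
      IsBigO.of_bound 1 (Eventually.of_forall fun n => ?_)⟩
    · rw [Real.norm_natCast, Real.norm_eq_abs, Real.abs_exp]
      exact expDen_le_exp n
    · rw [Real.norm_natCast, Real.norm_eq_abs, Real.abs_exp, one_mul]
      exact exp_expDen_le n
  · exact liminf_log_boundary hε tendsto_expDen exp_expDen_le fun n =>
      ⟨expNum (n + 1), mod_cast happrox n⟩
  · exact limsup_log_boundary hε (tendsto_natCast_atTop_atTop.comp tendsto_expDen)
      (Eventually.of_forall fun n _ hj0 hj m => le_abs_mul_sub hP hQ hP0 hP1 hQ0 hQ1 hα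
        (expDen_pos n) (two_mul_expDen_le n) hj0 hj m)
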